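/- Let $X$ be a locally compact, second countable, metrizable space with its Borel $\sigma$-algebra, let $U\subseteq X$ be open, let $\sigma:U\to X$ be a local homeomorphism, let $h:U\to\mathbb R$ be continuous, and put $\rho=e^{h}$. For a Borel function $f:U\to[0,\infty]$ let $L_\rho(f):X\to[0,\infty]$ be given by $$L_\rho(f)(x)=\sum_{t\in\sigma^{-1}(x)}\rho(t)f(t).$$ Put $U_0=X$ and $U_{n+1}=\{x\in U:\sigma(x)\in U_{n}\}$, so that $U_n$ is the domain of $\sigma^n$. Let $R_n=\{(x,y)\in U_n\times U_n:\sigma^n(x)=\sigma^n(y)\}$ with the topology induced from $X\times X$, and let $R=\bigcup_{n\ge 0}R_n$, with the topology in which $O\subseteq R$ is open if and only if $O\cap R_n$ is open in $R_n$ for every $n$. Let $c:R\to\mathbb R$ be the (well defined) function with $$c(x,y)=\sum_{i=0}^{n-1}\Big(h(\sigma^i(x))-h(\sigma^i(y))\Big)\qquad\text{for }(x,y)\in R_n .$$ Theorem. Let $\mu$ be a finite (positive) Borel measure on $X$ and let $\lambda\neq0$ be a real number such that $$\int_X L_\rho(f)\,d\mu=\lambda\int_U f\,d\mu\qquad\text{for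 all Borel functions } f:U\to[0,\infty].$$ Then $\mu$ is a DLR measure for $h$, that is, $\mu$ is quasi-invariant relative to the cocycle $e^{c}$ on $R$: for every continuous, compactly supported function $f:R\to\mathbb C$, $$\int_X\ \sum_{y:\,(x,y)\in R} f(x,y)\,d\mu(x)=\int_X\ \sum_{x:\,(x,y)\in R} f(x,y)\,e^{c(x,y)}\,d\mu(y).$$ -/

import Mathlib

open MeasureTheory TopologicalSpace
open scoped ENNReal

namespace EigenDLR

noncomputable section

/-- Quasi-invariance of a measure `μ` on the unit space `X` of an étale groupoid `G` with range map
`r`, source map `s`, relative to a multiplicative cocycle `D`: for every `f ∈ C_c(G)`,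
`∫ ∑_{r γ = x} f γ dμ(x) = ∫ ∑_{s γ = x} f γ D γ dμ(x)`. -/
def QuasiInvariant {G X : Type*} [TopologicalSpace G] [MeasurableSpace X]
    (r s : G → X) (D : G → ℝ) (μ : Measure X) : Prop :=
  ∀ f : CompactlySupportedContinuousMap G ℂ,
    ∫ x, ∑' γ : r ⁻¹' {x}, f γ ∂μ = ∫ x, ∑' γ : s ⁻¹' {x}, f γ * (D γ : ℂ) ∂μ

variable {X : Type*} [TopologicalSpace X] {U : Opens X}

/-- `U_n`, the domain of `σ^n`: `U_0 = X` and `U_{n+1} = {x ∈ U : σ x ∈ U_n}`. -/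
def iterDom (σ : U → X) : ℕ → Set X
  | 0 => Set.univ
  | n + 1 => {x | ∃ hx : x ∈ U, σ ⟨x, hx⟩ ∈ iterDom σ n}

/-- The partially defined iterate `σ^n : U_n → X`. -/
def iter (σ : U → X) : (n : ℕ) → iterDom σ n → X
  | 0, x => x
  | n + 1, x => iter σ n ⟨σ ⟨x, x.2.fst⟩, x.2.snd⟩

theorem iterDom_succ_subset (σ : U → X) (n : ℕ) : iterDom σ (n + 1) ⊆ iterDom σ n := by
  induction n with
  | zero => exact fun _ _ => trivial
  | succ n ih => exact fun x hx => ⟨hx.fst, ih hx.snd⟩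

theorem iterDom_antitone (σ : U → X) : Antitone (iterDom σ) :=
  antitone_nat_of_succ_le (iterDom_succ_subset σ)

theorem iter_mem (σ : U → X) (n : ℕ) (x : X) (hx : x ∈ iterDom σ (n + 1)) :
    iter σ n ⟨x, iterDom_succ_subset σ n hx⟩ ∈ U := by
  induction n generalizing x with
  | zero => exact hx.fst
  | succ n ih => exact ih (σ ⟨x, hx.fst⟩) hx.snd

/-- `R_n = {(x, y) ∈ U_n × U_n : σ^n x = σ^n y}`. -/
def rel (σ : U → X) (n : ℕ) : Set (X × X) :=
  {p | ∃ (h₁ : p.1 ∈ iterDom σ n) (h₂ : p.2 ∈ iterDom σ n),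
    iter σ n ⟨p.1, h₁⟩ = iter σ n ⟨p.2, h₂⟩}

/-- The groupoid `R = ⋃ n, R_n`. -/
def GapGroupoid (σ : U → X) : Type _ := {p : X × X // ∃ n, p ∈ rel σ n}

/-- The range map `(x, y) ↦ x`. -/
def GapGroupoid.range {σ : U → X} (γ : GapGroupoid σ) : X := γ.1.1

/-- The source map `(x, y) ↦ y`. -/
def GapGroupoid.source {σ : U → X} (γ : GapGroupoid σ) : X := γ.1.2

/-- The inclusion of `R_n` in `R`. -/
def GapGroupoid.incl (σ : U → X) (n : ℕ) (p : rel σ n) : GapGroupoid σ := ⟨p.1, n, p.2⟩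

/-- The inductive limit topology on `R`: a set is open iff its intersection with each `R_n` is open
in `R_n`, where `R_n` has the topology induced by `X × X`. -/
instance (σ : U → X) : TopologicalSpace (GapGroupoid σ) :=
  ⨆ n, coinduced (GapGroupoid.incl σ n) inferInstance

theorem GapGroupoid.isOpen_iff (σ : U → X) (O : Set (GapGroupoid σ)) :
    IsOpen O ↔ ∀ n, IsOpen (GapGroupoid.incl σ n ⁻¹' O) := by
  change (@IsOpen _ (⨆ n, coinduced (GapGroupoid.incl σ n) inferInstance) O) ↔ _
  simp only [isOpen_iSup_iff, isOpen_coinduced]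

/-- `h_n(x) = h(x) + h(σ x) + ⋯ + h(σ^{n-1} x)` for `x ∈ U_n`. -/
def birkhoff (σ : U → X) (h : U → ℝ) (n : ℕ) (x : iterDom σ n) : ℝ :=
  ∑ i : Fin n, h ⟨iter σ i ⟨x, _⟩, iter_mem σ i x (iterDom_antitone σ i.2 x.2)⟩

/-- The cocycle `c` on `R`: `c(x, y) = h_n(x) - h_n(y)` when `(x, y) ∈ R_n`. The value does not
depend on `n`, see `cocycle_eq`. -/
def cocycle (σ : U → X) (h : U → ℝ) (γ : GapGroupoid σ) : ℝ :=
  birkhoff σ h γ.2.choose ⟨γ.1.1, γ.2.choose_spec.fst⟩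
    - birkhoff σ h γ.2.choose ⟨γ.1.2, γ.2.choose_spec.snd.fst⟩

theorem iter_succ_eq (σ : U → X) (n : ℕ) (x : X) (hx : x ∈ iterDom σ (n + 1)) :
    iter σ (n + 1) ⟨x, hx⟩
      = σ ⟨iter σ n ⟨x, iterDom_succ_subset σ n hx⟩, iter_mem σ n x hx⟩ := by
  induction n generalizing x with
  | zero => rfl
  | succ n ih => exact ih (σ ⟨x, hx.fst⟩) hx.snd

theorem birkhoff_succ (σ : U → X) (h : U → ℝ) (n : ℕ) (x : X) (hx : x ∈ iterDom σ (n + 1)) :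
    birkhoff σ h (n + 1) ⟨x, hx⟩ = birkhoff σ h n ⟨x, iterDom_succ_subset σ n hx⟩
      + h ⟨iter σ n ⟨x, iterDom_succ_subset σ n hx⟩, iter_mem σ n x hx⟩ := by
  simp [birkhoff, Fin.sum_univ_castSucc]

theorem birkhoff_sub_eq (σ : U → X) (h : U → ℝ) {n m : ℕ} (hnm : n ≤ m) {x y : X}
    (hx : x ∈ iterDom σ m) (hy : y ∈ iterDom σ m)
    (hxy : iter σ n ⟨x, iterDom_antitone σ hnm hx⟩ = iter σ n ⟨y, iterDom_antitone σ hnm hy⟩) :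
    iter σ m ⟨x, hx⟩ = iter σ m ⟨y, hy⟩ ∧
    birkhoff σ h m ⟨x, hx⟩ - birkhoff σ h m ⟨y, hy⟩
      = birkhoff σ h n ⟨x, iterDom_antitone σ hnm hx⟩
        - birkhoff σ h n ⟨y, iterDom_antitone σ hnm hy⟩ := by
  induction m, hnm using Nat.le_induction with
  | base => exact ⟨hxy, rfl⟩
  | succ m hnm ih =>
    obtain ⟨h1, h2⟩ := ih (iterDom_succ_subset σ m hx) (iterDom_succ_subset σ m hy) hxy
    refine ⟨?_, ?_⟩
    · rw [iter_succ_eq, iter_succ_eq]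
      simp only [h1]
    · rw [birkhoff_succ, birkhoff_succ, ← h2]
      simp only [h1]
      ring

/-- The cocycle is well defined: it agrees with `c_n` on each `R_n`. -/
theorem cocycle_eq (σ : U → X) (h : U → ℝ) (n : ℕ) (γ : GapGroupoid σ) (hγ : γ.1 ∈ rel σ n) :
    cocycle σ h γ = birkhoff σ h n ⟨γ.1.1, hγ.fst⟩ - birkhoff σ h n ⟨γ.1.2, hγ.snd.fst⟩ := by
  unfold cocycle
  have hm := γ.2.choose_spec
  rcases le_total γ.2.choose n with hle | hle
  · exact (birkhoff_sub_eq σ h hle hγ.fst hγ.snd.fst hm.snd.snd).2.symm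
  · exact (birkhoff_sub_eq σ h hle hm.fst hm.snd.fst hγ.snd.snd).2

/-- A DLR measure for the potential `h`: quasi-invariant relative to `e^c` on the groupoid `R`. -/
def IsDLR [MeasurableSpace X] (σ : U → X) (h : U → ℝ) (μ : Measure X) : Prop :=
  QuasiInvariant GapGroupoid.range GapGroupoid.source
    (fun γ : GapGroupoid σ => Real.exp (cocycle σ h γ)) μ

/-- `L(f)(x) = ∑_{t ∈ σ⁻¹(x)} f(t)`, for `f : U → [0, ∞]`. -/
def transfer (σ : U → X) (f : U → ℝ≥0∞) (x : X) : ℝ≥0∞ := ∑' t : σ ⁻¹' {x}, f t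

/-- The Ruelle operator `L_ρ(f) = L(ρ f)` with `ρ = e^h`. -/
def ruelle (σ : U → X) (h : U → ℝ) (f : U → ℝ≥0∞) : X → ℝ≥0∞ :=
  transfer σ (fun t => ENNReal.ofReal (Real.exp (h t)) * f t)

/-- `∫_X L_ρ(f) dμ = a ∫_U f dμ` for all Borel `f : U → [0, ∞]`. Both integrals take values in
`[0, ∞]`; the identity is read in the extended reals, so that the scalar `a` may be any real. -/
def IsRuelleEigenmeasure [MeasurableSpace X] (σ : U → X) (h : U → ℝ) (μ : Measure X) (a : ℝ) :
    Prop :=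
  ∀ f : U → ℝ≥0∞, Measurable f →
    ((∫⁻ x, ruelle σ h f x ∂μ : ℝ≥0∞) : EReal)
      = (a : EReal) * ((∫⁻ u, f u ∂(μ.comap (Subtype.val : U → X)) : ℝ≥0∞) : EReal)

end

end EigenDLR

/-!
For a single local homeomorphism `τ : V → X` and a weight `ρ` on `V`, suppose that summing over the
fibres of `τ` with weight `ρ` carries a measure `μ` on `X` to a nonzero multiple `b` of a measure
`ν` on `V`. Then, for a Borel function `G ≥ 0` on `V × V`, both `b ∫ ∑_{y : τ y = τ x} G(x, y) dν(x)`
and `b ∫ ∑_{x : τ x = τ y} G(x, y) ρ(x) / ρ(y) dν(y)` are equal to the integral against `μ` of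
`z ↦ ∑_{x, y ∈ τ⁻¹(z)} ρ(x) G(x, y)`, so that `ν` is quasi-invariant with cocycle `ρ(x) / ρ(y)`
(`lintegral_tsum_fiber_swap`). The functions that occur are Borel because a local homeomorphism of a
second countable space has countably many Borel sections that exhaust its fibres
(`measurable_tsum_fiber`).

Iterating the eigenvalue equation gives this hypothesis for `τ = σ^n : U_n → X` and the weight
`exp (birkhoff σ h n)` (`lintegral_tsum_iter_fiber`), hence quasi-invariance for functions supported
in `R_n`. Each `R_n` is Borel, so a function on the groupoid is a countable sum of such functions;
this proves quasi-invariance for all Borel functions with values in `[0, ∞]`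
(`lintegral_tsum_range_eq`).

To pass to complex functions in `C_c(R)` one needs integrability. The range map is locally
injective on `R`, because every `R_n` is open in `R`; so the fibre sums of `|f|` are bounded for `f`
with compact support (`exists_tsum_enorm_range_le`), and `μ` is finite.
-/

namespace EigenDLR

/-! ### Sums over the fibres of a local homeomorphism -/

/-- The inverse of a partial homeomorphism may be discontinuous off the target, so measurability is
claimed only for the function cut off there. -/
theorem measurable_indicator_symm_comp {P V X : Type*} [MeasurableSpace P]
    [TopologicalSpace V] [MeasurableSpace V] [BorelSpace V]
    [TopologicalSpace X] [MeasurableSpace X] [BorelSpace X]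
    (e : OpenPartialHomeomorph V X) {φ : P → X} (hφ : Measurable φ)
    {H : P × V → ℝ≥0∞} (hH : Measurable H) :
    Measurable ((φ ⁻¹' e.target).indicator fun p => H (p, e.symm (φ p))) := by
  have hm : MeasurableSet (φ ⁻¹' e.target) := hφ e.open_target.measurableSet
  refine measurable_of_restrict_of_restrict_compl hm ?_ ?_
  · have hc : Measurable (fun z : e.target => e.symm z) :=
      (continuousOn_iff_continuous_domRestrict.1 e.continuousOn_symm).measurable
    have : Measurable fun p : (φ ⁻¹' e.target : Set P) => H (p.1, e.symm (φ p.1)) :=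
      hH.comp (measurable_subtype_coe.prodMk
        (hc.comp (Measurable.subtype_mk (hφ.comp measurable_subtype_coe) (h := fun p => p.2))))
    convert this using 1
    ext p
    exact Set.indicator_of_mem p.2 fun p => H (p, e.symm (φ p))
  · convert (measurable_const : Measurable fun _ : ((φ ⁻¹' e.target)ᶜ : Set P) => (0 : ℝ≥0∞)) using 1
    ext p
    exact Set.indicator_of_notMem p.2 _

/-- Sums over the fibres of a local homeomorphism depend measurably on parameters: the space is
cut into countably many Borel pieces on each of which the map has a Borel inverse. -/
theorem measurable_tsum_fiber {P V X : Type*} [MeasurableSpace P]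
    [TopologicalSpace V] [SecondCountableTopology V] [MeasurableSpace V] [BorelSpace V]
    [TopologicalSpace X] [MeasurableSpace X] [BorelSpace X]
    {τ : V → X} (hτ : IsLocalHomeomorph τ) {φ : P → X} (hφ : Measurable φ)
    {H : P × V → ℝ≥0∞} (hH : Measurable H) :
    Measurable fun p => ∑' t : τ ⁻¹' {φ p}, H (p, t) := by
  -- Partial homeomorphisms `e v` that agree with `τ`; countably many sources cover `V`, and each
  -- of the disjointed sources meets a fibre of `τ` in at most one point.
  choose e hes heq using hτ
  obtain ⟨T, hTc, hT⟩ := countable_cover_nhds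
    (f := fun v => (e v).source) fun v => (e v).open_source.mem_nhds (hes v)
  rcases isEmpty_or_nonempty V with hV | hV
  · simp
  have hTn : T.Nonempty := by
    rw [Set.nonempty_iff_ne_empty]
    rintro rfl
    simpa using hT.symm
  obtain ⟨a, ha⟩ := hTc.exists_eq_range hTn
  set S : ℕ → Set V := fun i => (e (a i)).source with hS
  have hSU : ⋃ i, disjointed S i = Set.univ := by
    rw [iUnion_disjointed, ← hT, ha]
    simp [hS]
  have hSm : ∀ i, MeasurableSet (disjointed S i) :=
    fun i => MeasurableSet.disjointed (fun j => (e (a j)).open_source.measurableSet) i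
  have key : (fun p => ∑' t : τ ⁻¹' {φ p}, H (p, t)) = fun p => ∑' i,
      (φ ⁻¹' (e (a i)).target).indicator
        (fun p => (Prod.snd ⁻¹' disjointed S i).indicator H (p, (e (a i)).symm (φ p))) p := by
    funext p
    have h1 : ∀ t : V, H (p, t) = ∑' i, (Prod.snd ⁻¹' disjointed S i).indicator H (p, t) := by
      intro t
      obtain ⟨i, hi⟩ := Set.mem_iUnion.1 (hSU.symm ▸ Set.mem_univ t : t ∈ ⋃ i, disjointed S i)
      rw [tsum_eq_single i, Set.indicator_of_mem (by exact hi)]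
      intro j hj
      refine Set.indicator_of_notMem (fun hj' => ?_) _
      exact Set.disjoint_left.1 (disjoint_disjointed S hj) hj' hi
    calc _ = ∑' t : τ ⁻¹' {φ p}, ∑' i, (Prod.snd ⁻¹' disjointed S i).indicator H (p, (t : V)) :=
          tsum_congr fun t => h1 t
      _ = ∑' i, ∑' t : τ ⁻¹' {φ p}, (Prod.snd ⁻¹' disjointed S i).indicator H (p, (t : V)) :=
          ENNReal.tsum_comm
      _ = _ := by
        refine tsum_congr fun i => ?_
        by_cases hp : φ p ∈ (e (a i)).target
        · rw [Set.indicator_of_mem (by exact hp)]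
          have hmem : (e (a i)).symm (φ p) ∈ τ ⁻¹' {φ p} := by
            have := (e (a i)).right_inv hp
            rwa [← heq (a i)] at this
          rw [tsum_eq_single (⟨_, hmem⟩ : τ ⁻¹' {φ p})]
          rintro ⟨t, ht⟩ hne
          refine Set.indicator_of_notMem (fun hj' => hne ?_) _
          have hts : t ∈ (e (a i)).source := disjointed_subset S i hj'
          refine Subtype.ext ?_
          have ht' : τ t = φ p := ht
          calc t = (e (a i)).symm (e (a i) t) := ((e (a i)).left_inv hts).symm
            _ = (e (a i)).symm (φ p) := by rw [← heq (a i), ht']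
        · rw [Set.indicator_of_notMem (by exact hp)]
          refine ENNReal.tsum_eq_zero.2 fun t => Set.indicator_of_notMem (fun hj' => hp ?_) _
          have hts : (t : V) ∈ (e (a i)).source := disjointed_subset S i hj'
          have ht' : τ t = φ p := t.2
          have hmap := (e (a i)).map_source hts
          rwa [← congrFun (heq (a i)) t, ht'] at hmap
  rw [key]
  exact Measurable.tsum fun i => measurable_indicator_symm_comp _ hφ
    (hH.indicator (measurable_snd (hSm i)))

/-- If summation over the fibres of `τ` with weight `ρ` carries `μ` to a multiple of `ν`, then `ν`
is quasi-invariant, with cocycle `ρ x / ρ y`, under the relation `τ x = τ y`: both sides are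
multiples of the integral over `z` of the sum over all pairs `(x, y)` of points above `z`. -/
theorem lintegral_tsum_fiber_swap {V X : Type*}
    [TopologicalSpace V] [SecondCountableTopology V] [MeasurableSpace V] [BorelSpace V]
    [TopologicalSpace X] [MeasurableSpace X] [BorelSpace X]
    {τ : V → X} (hτ : IsLocalHomeomorph τ) {μ : Measure X} {ν : Measure V}
    {ρ : V → ℝ≥0∞} (hρm : Measurable ρ) (hρ0 : ∀ v, ρ v ≠ 0) (hρt : ∀ v, ρ v ≠ ⊤)
    {b : ℝ≥0∞} (hb0 : b ≠ 0) (hbt : b ≠ ⊤)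
    (hμ : ∀ g : V → ℝ≥0∞, Measurable g →
      ∫⁻ z, ∑' t : τ ⁻¹' {z}, ρ t * g t ∂μ = b * ∫⁻ v, g v ∂ν)
    {G : V × V → ℝ≥0∞} (hG : Measurable G) :
    ∫⁻ x, ∑' y : τ ⁻¹' {τ x}, G (x, y) ∂ν
      = ∫⁻ y, ∑' x : τ ⁻¹' {τ y}, G (x, y) * (ρ x / ρ y) ∂ν := by
  have hτm : Measurable τ := hτ.continuous.measurable
  refine (ENNReal.mul_right_inj hb0 hbt).1 ?_
  -- The transfer identity is applied to the two fibre sums, from right to left.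
  rw [← hμ _ (measurable_tsum_fiber hτ hτm hG),
    ← hμ _ (measurable_tsum_fiber (P := V) hτ hτm
      (H := fun q => G (q.2, q.1) * (ρ q.2 / ρ q.1)) (by fun_prop))]
  refine lintegral_congr fun z => ?_
  have h1 : ∀ F : V → V → ℝ≥0∞, ∑' t : τ ⁻¹' {z}, ρ t * ∑' s : τ ⁻¹' {τ t}, F t s
      = ∑' t : τ ⁻¹' {z}, ∑' s : τ ⁻¹' {z}, ρ t * F t s := by
    refine fun F => tsum_congr ?_
    rintro ⟨t, rfl⟩
    exact ENNReal.tsum_mul_left.symm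
  rw [h1 fun x y => G (x, y), h1 fun y x => G (x, y) * (ρ x / ρ y), ENNReal.tsum_comm]
  refine tsum_congr fun y => tsum_congr fun x => ?_
  rw [mul_left_comm, ENNReal.mul_div_cancel (hρ0 _) (hρt _), mul_comm]

theorem lintegral_extend_val {X : Type*} [MeasurableSpace X] {s : Set X} (hs : MeasurableSet s)
    (μ : Measure X) (g : s → ℝ≥0∞) :
    ∫⁻ x, Function.extend Subtype.val g 0 x ∂μ = ∫⁻ v, g v ∂(μ.comap Subtype.val) := by
  have h1 : Function.extend Subtype.val g 0 = s.indicator (Function.extend Subtype.val g 0) := by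
    refine (Set.indicator_eq_self.2 fun x hx => ?_).symm
    by_contra hxs
    refine hx (Function.extend_apply' _ _ _ ?_)
    rintro ⟨v, rfl⟩
    exact hxs v.2
  rw [h1, lintegral_indicator hs, ← lintegral_subtype_comap hs]
  simp only [Subtype.val_injective.extend_apply]

/-! ### Iterates of the Ruelle operator -/

variable {X : Type*} [TopologicalSpace X] {U : Opens X} {σ : U → X}

/-- `σ` as a map from the domain of `σ ^ (n + 1)` to the domain of `σ ^ n`. -/
def shift (σ : U → X) (n : ℕ) (x : iterDom σ (n + 1)) : iterDom σ n :=
  ⟨σ ⟨x, x.2.fst⟩, x.2.snd⟩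

theorem isOpen_iterDom (hσ : Continuous σ) (n : ℕ) : IsOpen (iterDom σ n) := by
  induction n with
  | zero => exact isOpen_univ
  | succ n ih =>
    have : iterDom σ (n + 1) = Subtype.val '' (σ ⁻¹' iterDom σ n) := by
      ext x
      simp [iterDom]
    rw [this]
    exact U.isOpen.isOpenMap_subtype_val _ (ih.preimage hσ)

theorem isLocalHomeomorph_shift (hσ : IsLocalHomeomorph σ) (n : ℕ) :
    IsLocalHomeomorph (shift σ n) := by
  have hin : IsLocalHomeomorph fun x : iterDom σ (n + 1) => (⟨x, x.2.fst⟩ : U) :=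
    ((isOpen_iterDom hσ.continuous (n + 1)).isOpenEmbedding_subtypeVal.isLocalHomeomorph).of_comp
      (g := (Subtype.val : U → X)) U.isOpen.isOpenEmbedding_subtypeVal.isLocalHomeomorph
      (by fun_prop)
  refine IsLocalHomeomorph.of_comp (g := (Subtype.val : iterDom σ n → X)) ?_
    (isOpen_iterDom hσ.continuous n).isOpenEmbedding_subtypeVal.isLocalHomeomorph ?_
  · exact hσ.comp hin
  · exact (hσ.continuous.comp hin.continuous).subtype_mk _

theorem isLocalHomeomorph_iter (hσ : IsLocalHomeomorph σ) (n : ℕ) :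
    IsLocalHomeomorph (iter σ n) := by
  induction n with
  | zero => exact isOpen_univ.isOpenEmbedding_subtypeVal.isLocalHomeomorph
  | succ n ih => exact ih.comp (isLocalHomeomorph_shift hσ n)

theorem birkhoff_succ_eq_add_shift (σ : U → X) (h : U → ℝ) (n : ℕ) (x : iterDom σ (n + 1)) :
    birkhoff σ h (n + 1) x = h ⟨x, x.2.fst⟩ + birkhoff σ h n (shift σ n x) := by
  simp only [birkhoff, Fin.sum_univ_succ]
  rfl

theorem continuous_birkhoff (hσ : IsLocalHomeomorph σ) {h : U → ℝ} (hh : Continuous h) (n : ℕ) :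
    Continuous (birkhoff σ h n) := by
  induction n with
  | zero =>
    have : birkhoff σ h 0 = fun _ => 0 := by
      funext x
      simp [birkhoff]
    rw [this]
    exact continuous_const
  | succ n ih =>
    rw [funext (birkhoff_succ_eq_add_shift σ h n)]
    exact (hh.comp (by fun_prop)).add (ih.comp (isLocalHomeomorph_shift hσ n).continuous)

/-- The eigenvalue may be taken to be a positive extended nonnegative real: if it is negative,
both sides of the eigenvalue equation vanish identically and any scalar will do. -/
theorem IsRuelleEigenmeasure.exists_scalar [MeasurableSpace X] {h : U → ℝ} {μ : Measure X} {a : ℝ}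
    (ha : a ≠ 0) (hμ : IsRuelleEigenmeasure σ h μ a) :
    ∃ b : ℝ≥0∞, b ≠ 0 ∧ b ≠ ⊤ ∧ ∀ f : U → ℝ≥0∞, Measurable f →
      ∫⁻ x, ruelle σ h f x ∂μ = b * ∫⁻ u, f u ∂(μ.comap (Subtype.val : U → X)) := by
  rcases ha.lt_or_gt with ha | ha
  · refine ⟨1, one_ne_zero, ENNReal.one_ne_top, fun f hf => ?_⟩
    have h1 := hμ f hf
    set l := ∫⁻ x, ruelle σ h f x ∂μ
    set r := ∫⁻ u, f u ∂(μ.comap (Subtype.val : U → X))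
    have ha' : (a : EReal) < 0 := by exact_mod_cast ha
    have hr : r = 0 := by
      by_contra hr
      have hr' : (0 : EReal) < (r : EReal) := by
        exact_mod_cast pos_iff_ne_zero.2 hr
      have h2 : (a : EReal) * (r : EReal) < 0 := EReal.mul_neg_iff.2 (Or.inr ⟨ha', hr'⟩)
      rw [← h1] at h2
      exact h2.not_ge (EReal.coe_ennreal_nonneg l)
    rw [hr] at h1
    rw [hr, mul_zero]
    simpa using h1
  · refine ⟨ENNReal.ofReal a, by simpa using ha, ENNReal.ofReal_ne_top, fun f hf => ?_⟩
    have h1 := hμ f hf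
    have h2 : (a : EReal) = (ENNReal.ofReal a : ℝ≥0∞) := by
      rw [EReal.coe_ennreal_ofReal, max_eq_left ha.le]
    rw [h2, ← EReal.coe_ennreal_mul] at h1
    exact EReal.coe_ennreal_injective h1

theorem tsum_iter_succ_fiber (σ : U → X) (n : ℕ) (F : iterDom σ (n + 1) → ℝ≥0∞) (z : X) :
    ∑' t : iter σ (n + 1) ⁻¹' {z}, F t
      = ∑' s : iter σ n ⁻¹' {z}, ∑' t : shift σ n ⁻¹' {(s : iterDom σ n)}, F t := by
  classical
  rw [tsum_subtype, tsum_subtype (iter σ n ⁻¹' {z})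
    fun s => ∑' t : shift σ n ⁻¹' {s}, F t]
  simp only [tsum_subtype]
  have h1 : ∀ s, (iter σ n ⁻¹' {z}).indicator
      (fun s => ∑' t, (shift σ n ⁻¹' {s}).indicator F t) s
      = ∑' t, if s = shift σ n t then (iter σ (n + 1) ⁻¹' {z}).indicator F t else 0 := by
    intro s
    by_cases hs : iter σ n s = z
    · rw [Set.indicator_of_mem (by exact hs)]
      refine tsum_congr fun t => ?_
      by_cases ht : s = shift σ n t
      · subst ht
        rw [if_pos rfl, Set.indicator_of_mem (by rfl), Set.indicator_of_mem (by exact hs)]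
      · rw [if_neg ht, Set.indicator_of_notMem (by exact fun h => ht h.symm)]
    · rw [Set.indicator_of_notMem (by exact hs)]
      refine (ENNReal.tsum_eq_zero.2 fun t => ?_).symm
      split_ifs with ht
      · subst ht
        exact Set.indicator_of_notMem (by exact hs) F
      · rfl
  rw [tsum_congr h1, ENNReal.tsum_comm]
  exact tsum_congr fun t => (tsum_ite_eq (shift σ n t)
    fun _ => (iter σ (n + 1) ⁻¹' {z}).indicator F t).symm

theorem extend_val_of_mem {α β : Type*} [Zero β] {s : Set α} (g : s → β) {x : α} (hx : x ∈ s) :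
    Function.extend Subtype.val g 0 x = g ⟨x, hx⟩ :=
  Subtype.val_injective.extend_apply g 0 ⟨x, hx⟩

theorem extend_val_of_notMem {α β : Type*} [Zero β] {s : Set α} (g : s → β) {x : α}
    (hx : x ∉ s) : Function.extend Subtype.val g 0 x = 0 := by
  refine Function.extend_apply' _ _ _ ?_
  rintro ⟨v, rfl⟩
  exact hx v.2

/-- The Ruelle operator on functions supported in `U_{n+1}` is fibre summation along
`U_{n+1} → U_n`. -/
theorem ruelle_extend (σ : U → X) (h : U → ℝ) (n : ℕ) (g : iterDom σ (n + 1) → ℝ≥0∞) :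
    ruelle σ h (fun u => Function.extend Subtype.val g 0 (u : X))
      = Function.extend Subtype.val (fun s : iterDom σ n => ∑' t : shift σ n ⁻¹' {s},
          ENNReal.ofReal (Real.exp (h ⟨t, t.1.2.fst⟩)) * g t) 0 := by
  funext x
  unfold ruelle transfer
  by_cases hx : x ∈ iterDom σ n
  · rw [extend_val_of_mem _ hx]
    let ψ : shift σ n ⁻¹' {(⟨x, hx⟩ : iterDom σ n)} → σ ⁻¹' {x} :=
      fun t => ⟨⟨t, t.1.2.fst⟩, congrArg Subtype.val t.2⟩
    have hψ : Function.Injective ψ := by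
      intro s t hst
      exact Subtype.ext (Subtype.ext (congrArg (fun u : σ ⁻¹' {x} => ((u : U) : X)) hst))
    rw [← hψ.tsum_eq]
    · refine tsum_congr fun t => ?_
      simp only [ψ]
      rw [extend_val_of_mem _ t.1.2]
    · rintro ⟨u, hu⟩ hne
      have hmem : (u : X) ∈ iterDom σ (n + 1) := by
        by_contra hc
        refine hne ?_
        simp only
        rw [extend_val_of_notMem _ hc, mul_zero]
      have hu' : σ u = x := hu
      exact ⟨⟨⟨u, hmem⟩, Subtype.ext hu'⟩, rfl⟩
  · rw [extend_val_of_notMem _ hx]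
    refine ENNReal.tsum_eq_zero.2 ?_
    rintro ⟨u, hu⟩
    have hu' : σ u = x := hu
    simp only
    rw [extend_val_of_notMem, mul_zero]
    rintro ⟨h1, h2⟩
    exact hx (hu' ▸ h2)

/-- The eigenvalue equation for the `n`-th power of the Ruelle operator. -/
theorem lintegral_tsum_iter_fiber [SecondCountableTopology X] [MeasurableSpace X] [BorelSpace X]
    (hσ : IsLocalHomeomorph σ) {h : U → ℝ} (hh : Continuous h) {μ : Measure X} {b : ℝ≥0∞}
    (hμ : ∀ f : U → ℝ≥0∞, Measurable f →
      ∫⁻ x, ruelle σ h f x ∂μ = b * ∫⁻ u, f u ∂(μ.comap (Subtype.val : U → X)))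
    (n : ℕ) (g : iterDom σ n → ℝ≥0∞) (hg : Measurable g) :
    ∫⁻ z, ∑' t : iter σ n ⁻¹' {z}, ENNReal.ofReal (Real.exp (birkhoff σ h n t)) * g t ∂μ
      = b ^ n * ∫⁻ v, g v ∂(μ.comap (Subtype.val : iterDom σ n → X)) := by
  have hmeas : ∀ n, MeasurableSet (iterDom σ n) :=
    fun n => (isOpen_iterDom hσ.continuous n).measurableSet
  induction n with
  | zero =>
    rw [pow_zero, one_mul, ← lintegral_extend_val (hmeas 0)]
    refine lintegral_congr fun z => ?_
    rw [extend_val_of_mem g (Set.mem_univ z),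
      tsum_eq_single (⟨⟨z, trivial⟩, rfl⟩ : iter σ 0 ⁻¹' {z})]
    · simp [birkhoff]
    · rintro ⟨t, ht⟩ hne
      have ht' : (t : X) = z := ht
      exact absurd (Subtype.ext (Subtype.ext ht')) hne
  | succ n ih =>
    set k : iterDom σ n → ℝ≥0∞ := fun s => ∑' t : shift σ n ⁻¹' {s},
      ENNReal.ofReal (Real.exp (h ⟨t, t.1.2.fst⟩)) * g t with hk
    have hkm : Measurable k := by
      refine measurable_tsum_fiber (isLocalHomeomorph_shift hσ n) measurable_id
        (H := fun p => ENNReal.ofReal (Real.exp (h ⟨p.2, p.2.2.fst⟩)) * g p.2) ?_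
      have h1 : Measurable fun t : iterDom σ (n + 1) => h ⟨t, t.2.fst⟩ :=
        (hh.comp (by fun_prop)).measurable
      exact ((ENNReal.measurable_ofReal.comp (Real.measurable_exp.comp h1)).mul hg).comp
        measurable_snd
    have hgm : Measurable (Function.extend Subtype.val g 0) :=
      (MeasurableEmbedding.subtype_coe (hmeas (n + 1))).measurable_extend hg measurable_zero
    have h1 : ∀ z, ∑' t : iter σ (n + 1) ⁻¹' {z},
        ENNReal.ofReal (Real.exp (birkhoff σ h (n + 1) t)) * g t
        = ∑' s : iter σ n ⁻¹' {z}, ENNReal.ofReal (Real.exp (birkhoff σ h n s)) * k s := by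
      intro z
      rw [tsum_iter_succ_fiber σ n
        (fun t => ENNReal.ofReal (Real.exp (birkhoff σ h (n + 1) t)) * g t)]
      refine tsum_congr fun s => ?_
      rw [hk, ← ENNReal.tsum_mul_left]
      refine tsum_congr ?_
      rintro ⟨t, ht⟩
      have ht' : shift σ n t = s := ht
      rw [birkhoff_succ_eq_add_shift, ht', Real.exp_add, ENNReal.ofReal_mul (Real.exp_nonneg _)]
      ring
    rw [lintegral_congr h1, ih k hkm, ← lintegral_extend_val (hmeas n), ← ruelle_extend,
      hμ (fun u => Function.extend Subtype.val g 0 (u : X))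
        (hgm.comp measurable_subtype_coe), ← mul_assoc, ← pow_succ,
      ← lintegral_extend_val (hmeas (n + 1))]
    refine congrArg (b ^ (n + 1) * ·) ((lintegral_extend_val U.isOpen.measurableSet μ
      fun u => Function.extend Subtype.val g 0 (u : X)).symm.trans ?_)
    refine lintegral_congr fun x => ?_
    by_cases hx : x ∈ (U : Set X)
    · rw [extend_val_of_mem _ hx]
    · rw [extend_val_of_notMem _ hx, extend_val_of_notMem]
      exact fun hx' => hx hx'.fst

/-! ### Quasi-invariance for nonnegative Borel functions -/

theorem mem_rel_of_eq {n : ℕ} {x y : iterDom σ n} (hxy : iter σ n x = iter σ n y) :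
    ((x : X), (y : X)) ∈ rel σ n :=
  ⟨x.2, y.2, hxy⟩

theorem swap_mem_rel {n : ℕ} {p : X × X} (hp : p ∈ rel σ n) : p.swap ∈ rel σ n :=
  ⟨hp.snd.fst, hp.fst, hp.snd.snd.symm⟩

/-- Inversion `(x, y) ↦ (y, x)` on the groupoid. -/
def GapGroupoid.inv (γ : GapGroupoid σ) : GapGroupoid σ :=
  ⟨γ.1.swap, γ.2.choose, swap_mem_rel γ.2.choose_spec⟩

theorem tsum_source_fiber {α : Type*} [AddCommMonoid α] [TopologicalSpace α]
    (w : GapGroupoid σ → α) (x : X) :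
    ∑' γ : GapGroupoid.source (σ := σ) ⁻¹' {x}, w γ
      = ∑' γ : GapGroupoid.range (σ := σ) ⁻¹' {x}, w (γ : GapGroupoid σ).inv := by
  let e : (GapGroupoid.range ⁻¹' {x} : Set (GapGroupoid σ)) ≃
      (GapGroupoid.source ⁻¹' {x} : Set (GapGroupoid σ)) :=
    { toFun := fun γ => ⟨γ.1.inv, γ.2⟩
      invFun := fun γ => ⟨γ.1.inv, γ.2⟩
      left_inv := fun _ => rfl
      right_inv := fun _ => rfl }
  exact (e.tsum_eq fun γ => w γ).symm

/-- A function on the groupoid, restricted to `R_n` and extended by zero to `U_n × U_n`. -/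
noncomputable def pairExtend (n : ℕ) (w : GapGroupoid σ → ℝ≥0∞)
    (q : iterDom σ n × iterDom σ n) : ℝ≥0∞ :=
  Function.extend Subtype.val (w ∘ GapGroupoid.incl σ n) 0 ((q.1 : X), (q.2 : X))

/-- For `w` supported in `R_n`, the sum over the range fibre of `x` runs over the fibre of `σ^n`
through `x` if `x ∈ U_n`, and vanishes otherwise. -/
theorem tsum_range_fiber {n : ℕ} {w : GapGroupoid σ → ℝ≥0∞} (hw : ∀ γ, γ.1 ∉ rel σ n → w γ = 0) :
    (fun x => ∑' γ : GapGroupoid.range (σ := σ) ⁻¹' {x}, w γ)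
      = Function.extend Subtype.val (fun v : iterDom σ n =>
          ∑' y : iter σ n ⁻¹' {iter σ n v}, pairExtend n w (v, y)) 0 := by
  funext x
  by_cases hx : x ∈ iterDom σ n
  · rw [extend_val_of_mem _ hx]
    have hmem : ∀ y : iter σ n ⁻¹' {iter σ n ⟨x, hx⟩}, (x, ((y : iterDom σ n) : X)) ∈ rel σ n :=
      fun y => ⟨hx, y.1.2, y.2.symm⟩
    let ψ : iter σ n ⁻¹' {iter σ n ⟨x, hx⟩} →
        (GapGroupoid.range ⁻¹' {x} : Set (GapGroupoid σ)) :=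
      fun y => ⟨GapGroupoid.incl σ n ⟨_, hmem y⟩, rfl⟩
    have hψ : Function.Injective ψ := by
      intro s t hst
      exact Subtype.ext (Subtype.ext (congrArg
        (fun γ : (GapGroupoid.range ⁻¹' {x} : Set (GapGroupoid σ)) => γ.1.1.2) hst))
    rw [← hψ.tsum_eq]
    · refine tsum_congr fun y => ?_
      exact (extend_val_of_mem (w ∘ GapGroupoid.incl σ n) (hmem y)).symm
    · rintro ⟨γ, hγ⟩ hne
      have hr : γ.1 ∈ rel σ n := by
        by_contra hc
        exact hne (hw γ hc)
      obtain ⟨⟨x', y⟩, hxy⟩ := γ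
      obtain rfl : x' = x := hγ
      exact ⟨⟨⟨y, hr.snd.fst⟩, hr.snd.snd.symm⟩, rfl⟩
  · rw [extend_val_of_notMem _ hx]
    refine ENNReal.tsum_eq_zero.2 ?_
    rintro ⟨γ, hγ⟩
    have hγ' : γ.1.1 = x := hγ
    exact hw γ fun hr => hx (hγ' ▸ hr.fst)

/-- The cocycle `e ^ c` with values in `[0, ∞]`. -/
noncomputable def expCocycle (σ : U → X) (h : U → ℝ) (γ : GapGroupoid σ) : ℝ≥0∞ :=
  ENNReal.ofReal (Real.exp (cocycle σ h γ))

theorem expCocycle_incl (σ : U → X) (h : U → ℝ) (n : ℕ) (p : rel σ n) :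
    expCocycle σ h (GapGroupoid.incl σ n p)
      = ENNReal.ofReal (Real.exp (birkhoff σ h n ⟨p.1.1, p.2.fst⟩))
        / ENNReal.ofReal (Real.exp (birkhoff σ h n ⟨p.1.2, p.2.snd.fst⟩)) := by
  unfold expCocycle
  rw [cocycle_eq σ h n (GapGroupoid.incl σ n p) p.2, Real.exp_sub,
    ENNReal.ofReal_div_of_pos (Real.exp_pos _)]
  rfl

/-- The restriction of `w` to the `n`-th piece of the partition of the groupoid obtained by
disjointing the sets `R_n`. These are not nested: `R_0` is the diagonal of all of `X`. -/
noncomputable def piece (w : GapGroupoid σ → ℝ≥0∞) (n : ℕ) : GapGroupoid σ → ℝ≥0∞ :=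
  {γ | γ.1 ∈ disjointed (rel σ) n}.indicator w

theorem piece_eq_zero (w : GapGroupoid σ → ℝ≥0∞) (n : ℕ) (γ : GapGroupoid σ) (hγ : γ.1 ∉ rel σ n) :
    piece w n γ = 0 :=
  Set.indicator_of_notMem (by exact fun h => hγ (disjointed_subset _ _ h)) w

theorem tsum_piece (w : GapGroupoid σ → ℝ≥0∞) (γ : GapGroupoid σ) : ∑' n, piece w n γ = w γ := by
  have h1 : γ.1 ∈ ⋃ n, disjointed (rel σ) n := by
    rw [iUnion_disjointed]
    exact Set.mem_iUnion.2 γ.2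
  obtain ⟨n, hn⟩ := Set.mem_iUnion.1 h1
  rw [tsum_eq_single n]
  · exact Set.indicator_of_mem (by exact hn) _
  · intro m hm
    exact Set.indicator_of_notMem
      (by exact fun hm' => Set.disjoint_left.1 (disjoint_disjointed (rel σ) hm) hm' hn) w

theorem tsum_range_eq_tsum_piece (w : GapGroupoid σ → ℝ≥0∞) (x : X) :
    ∑' γ : GapGroupoid.range (σ := σ) ⁻¹' {x}, w γ
      = ∑' n, ∑' γ : GapGroupoid.range (σ := σ) ⁻¹' {x}, piece w n γ := by
  rw [ENNReal.tsum_comm]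
  exact tsum_congr fun γ => (tsum_piece w γ).symm

theorem measurable_comp_inv [MeasurableSpace X] {n : ℕ} {w : GapGroupoid σ → ℝ≥0∞}
    (hw : Measurable (w ∘ GapGroupoid.incl σ n)) :
    Measurable ((fun γ => w γ.inv) ∘ GapGroupoid.incl σ n) := by
  have h1 : Measurable fun p : rel σ n => (⟨p.1.swap, swap_mem_rel p.2⟩ : rel σ n) :=
    (measurable_swap.comp measurable_subtype_coe).subtype_mk
  exact hw.comp h1

theorem measurable_ofReal_exp_birkhoff [MeasurableSpace X] [BorelSpace X]
    (hσ : IsLocalHomeomorph σ) {h : U → ℝ}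
    (hh : Continuous h) (n : ℕ) :
    Measurable fun v : iterDom σ n => ENNReal.ofReal (Real.exp (birkhoff σ h n v)) :=
  ENNReal.measurable_ofReal.comp
    (Real.measurable_exp.comp (continuous_birkhoff hσ hh n).measurable)

theorem measurable_expCocycle_incl [MeasurableSpace X] [BorelSpace X]
    (hσ : IsLocalHomeomorph σ) {h : U → ℝ} (hh : Continuous h) (n : ℕ) :
    Measurable (expCocycle σ h ∘ GapGroupoid.incl σ n) := by
  rw [show expCocycle σ h ∘ GapGroupoid.incl σ n = _ from funext (expCocycle_incl σ h n)]
  have hm := measurable_ofReal_exp_birkhoff hσ hh n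
  exact (hm.comp (by fun_prop)).div (hm.comp (by fun_prop))

section Measurability

variable [SecondCountableTopology X] [T2Space X] [MeasurableSpace X] [BorelSpace X]

theorem measurableSet_rel (hσ : IsLocalHomeomorph σ) (n : ℕ) : MeasurableSet (rel σ n) := by
  have he := (isOpen_iterDom hσ.continuous n).isOpenEmbedding_subtypeVal
  have hc := (isLocalHomeomorph_iter hσ n).continuous
  have h1 : rel σ n = Prod.map Subtype.val Subtype.val ''
      {q : iterDom σ n × iterDom σ n | iter σ n q.1 = iter σ n q.2} := by
    ext p
    constructor
    · rintro ⟨h₁, h₂, h₃⟩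
      exact ⟨(⟨p.1, h₁⟩, ⟨p.2, h₂⟩), h₃, rfl⟩
    · rintro ⟨q, hq, rfl⟩
      exact ⟨q.1.2, q.2.2, hq⟩
  rw [h1]
  refine (he.prodMap he).measurableEmbedding.measurableSet_image.2 ?_
  exact (isClosed_eq (hc.comp continuous_fst) (hc.comp continuous_snd)).measurableSet

theorem measurable_pairExtend (hσ : IsLocalHomeomorph σ) (n : ℕ) {w : GapGroupoid σ → ℝ≥0∞}
    (hw : Measurable (w ∘ GapGroupoid.incl σ n)) : Measurable (pairExtend n w) :=
  ((MeasurableEmbedding.subtype_coe (measurableSet_rel hσ n)).measurable_extend hw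
    measurable_zero).comp (by fun_prop)

theorem measurable_tsum_range_of_support (hσ : IsLocalHomeomorph σ) {n : ℕ}
    {w : GapGroupoid σ → ℝ≥0∞} (hwm : Measurable (w ∘ GapGroupoid.incl σ n))
    (hw : ∀ γ, γ.1 ∉ rel σ n → w γ = 0) :
    Measurable fun x => ∑' γ : GapGroupoid.range (σ := σ) ⁻¹' {x}, w γ := by
  rw [tsum_range_fiber hw]
  refine (MeasurableEmbedding.subtype_coe
    (isOpen_iterDom hσ.continuous n).measurableSet).measurable_extend ?_ measurable_zero
  have hτ := isLocalHomeomorph_iter hσ n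
  exact measurable_tsum_fiber hτ hτ.continuous.measurable (measurable_pairExtend hσ n hwm)

/-- Quasi-invariance for functions supported in `R_n`, which only involves the map `σ ^ n`. -/
theorem lintegral_tsum_range_eq_of_support (hσ : IsLocalHomeomorph σ) {h : U → ℝ}
    (hh : Continuous h) {μ : Measure X} {b : ℝ≥0∞} (hb0 : b ≠ 0) (hbt : b ≠ ⊤)
    (hμ : ∀ f : U → ℝ≥0∞, Measurable f →
      ∫⁻ x, ruelle σ h f x ∂μ = b * ∫⁻ u, f u ∂(μ.comap (Subtype.val : U → X)))
    {n : ℕ} {w : GapGroupoid σ → ℝ≥0∞} (hwm : Measurable (w ∘ GapGroupoid.incl σ n))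
    (hw : ∀ γ, γ.1 ∉ rel σ n → w γ = 0) :
    ∫⁻ x, ∑' γ : GapGroupoid.range (σ := σ) ⁻¹' {x}, w γ ∂μ
      = ∫⁻ x, ∑' γ : GapGroupoid.source (σ := σ) ⁻¹' {x}, w γ * expCocycle σ h γ ∂μ := by
  have hm := (isOpen_iterDom hσ.continuous n).measurableSet
  have hinv : ∀ γ : GapGroupoid σ, γ.1 ∉ rel σ n → w γ.inv * expCocycle σ h γ.inv = 0 := by
    intro γ hγ
    rw [hw γ.inv fun h1 => hγ (swap_mem_rel h1), zero_mul]
  -- By inversion both sides become sums over range fibres, that is, over fibres of `σ^n`.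
  simp_rw [tsum_source_fiber fun γ => w γ * expCocycle σ h γ]
  rw [tsum_range_fiber hw, tsum_range_fiber hinv, lintegral_extend_val hm,
    lintegral_extend_val hm,
    lintegral_tsum_fiber_swap (isLocalHomeomorph_iter hσ n)
      (measurable_ofReal_exp_birkhoff hσ hh n) (fun v => by simp [Real.exp_pos])
      (fun v => ENNReal.ofReal_ne_top) (pow_ne_zero n hb0) (ENNReal.pow_ne_top hbt)
      (lintegral_tsum_iter_fiber hσ hh hμ n) (measurable_pairExtend hσ n hwm)]
  refine lintegral_congr fun y => tsum_congr ?_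
  rintro ⟨x, hx⟩
  have hxy : iter σ n x = iter σ n y := hx
  unfold pairExtend
  rw [extend_val_of_mem _ (mem_rel_of_eq hxy), extend_val_of_mem _ (mem_rel_of_eq hxy.symm)]
  exact congrArg (_ * ·) (expCocycle_incl σ h n ⟨_, mem_rel_of_eq hxy⟩).symm

theorem measurable_piece (hσ : IsLocalHomeomorph σ) {w : GapGroupoid σ → ℝ≥0∞} {m : ℕ}
    (hw : Measurable (w ∘ GapGroupoid.incl σ m)) (n : ℕ) :
    Measurable (piece w n ∘ GapGroupoid.incl σ m) :=
  hw.indicator (measurable_subtype_coe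
    (MeasurableSet.disjointed (fun k => measurableSet_rel hσ k) n))

theorem measurable_tsum_range (hσ : IsLocalHomeomorph σ) {w : GapGroupoid σ → ℝ≥0∞}
    (hw : ∀ n, Measurable (w ∘ GapGroupoid.incl σ n)) :
    Measurable fun x => ∑' γ : GapGroupoid.range (σ := σ) ⁻¹' {x}, w γ := by
  simp_rw [tsum_range_eq_tsum_piece w]
  exact Measurable.tsum fun n =>
    measurable_tsum_range_of_support hσ (measurable_piece hσ (hw n) n) (piece_eq_zero w n)

theorem measurable_tsum_source (hσ : IsLocalHomeomorph σ) {w : GapGroupoid σ → ℝ≥0∞}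
    (hw : ∀ n, Measurable (w ∘ GapGroupoid.incl σ n)) :
    Measurable fun x => ∑' γ : GapGroupoid.source (σ := σ) ⁻¹' {x}, w γ := by
  simp_rw [tsum_source_fiber w]
  exact measurable_tsum_range hσ fun n => measurable_comp_inv (hw n)

/-- Quasi-invariance for Borel functions with values in `[0, ∞]`. -/
theorem lintegral_tsum_range_eq (hσ : IsLocalHomeomorph σ) {h : U → ℝ}
    (hh : Continuous h) {μ : Measure X} {b : ℝ≥0∞} (hb0 : b ≠ 0) (hbt : b ≠ ⊤)
    (hμ : ∀ f : U → ℝ≥0∞, Measurable f →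
      ∫⁻ x, ruelle σ h f x ∂μ = b * ∫⁻ u, f u ∂(μ.comap (Subtype.val : U → X)))
    {w : GapGroupoid σ → ℝ≥0∞} (hw : ∀ n, Measurable (w ∘ GapGroupoid.incl σ n)) :
    ∫⁻ x, ∑' γ : GapGroupoid.range (σ := σ) ⁻¹' {x}, w γ ∂μ
      = ∫⁻ x, ∑' γ : GapGroupoid.source (σ := σ) ⁻¹' {x}, w γ * expCocycle σ h γ ∂μ := by
  have h1 : ∀ x, ∑' γ : GapGroupoid.source (σ := σ) ⁻¹' {x}, w γ * expCocycle σ h γ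
      = ∑' n, ∑' γ : GapGroupoid.source (σ := σ) ⁻¹' {x}, piece w n γ * expCocycle σ h γ := by
    intro x
    rw [ENNReal.tsum_comm]
    refine tsum_congr fun γ => ?_
    rw [ENNReal.tsum_mul_right, tsum_piece]
  simp_rw [h1, tsum_range_eq_tsum_piece w]
  rw [lintegral_tsum, lintegral_tsum]
  · exact tsum_congr fun n => lintegral_tsum_range_eq_of_support hσ hh hb0 hbt hμ
      (measurable_piece hσ (hw n) n) (piece_eq_zero w n)
  · exact fun n => (measurable_tsum_source hσ
      (w := fun γ => piece w n γ * expCocycle σ h γ) fun m =>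
      (measurable_piece hσ (hw m) n).mul (measurable_expCocycle_incl hσ hh m)).aemeasurable
  · exact fun n => (measurable_tsum_range hσ fun m => measurable_piece hσ (hw m) n).aemeasurable

end Measurability

/-! ### Local injectivity of the range map -/

theorem continuous_incl (σ : U → X) (n : ℕ) : Continuous (GapGroupoid.incl σ n) :=
  continuous_def.2 fun O hO => (GapGroupoid.isOpen_iff σ O).1 hO n

theorem continuous_source (σ : U → X) :
    Continuous (GapGroupoid.source : GapGroupoid σ → X) := by
  refine continuous_def.2 fun O hO => (GapGroupoid.isOpen_iff σ _).2 fun n => ?_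
  exact hO.preimage (continuous_snd.comp continuous_subtype_val)

theorem mem_rel_of_le {n m : ℕ} (hnm : n ≤ m) {p : X × X} (hp : p ∈ rel σ n)
    (h₁ : p.1 ∈ iterDom σ m) (h₂ : p.2 ∈ iterDom σ m) : p ∈ rel σ m :=
  ⟨h₁, h₂, (birkhoff_sub_eq σ 0 hnm h₁ h₂ hp.snd.snd).1⟩

/-- Since `σ` is locally injective, `σ^j x = σ^j y` is an open condition on the pairs with
`σ^{j+1} x = σ^{j+1} y`. -/
theorem isOpen_rel_in_rel_of_le (hσ : IsLocalHomeomorph σ) {n m : ℕ} (hnm : n ≤ m) :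
    IsOpen {p : rel σ m | p.1 ∈ rel σ n} := by
  induction hnm using Nat.decreasingInduction with
  | self =>
    convert isOpen_univ
    simp
  | of_succ j hj ih =>
    have hd : ∀ p : rel σ m, p.1.1 ∈ iterDom σ (j + 1) ∧ p.1.2 ∈ iterDom σ (j + 1) := fun p =>
      ⟨iterDom_antitone σ hj p.2.fst, iterDom_antitone σ hj p.2.snd.fst⟩
    have hc := (isLocalHomeomorph_iter hσ j).continuous
    let a : rel σ m → U := fun p => ⟨iter σ j ⟨p.1.1, iterDom_succ_subset σ j (hd p).1⟩,
      iter_mem σ j _ (hd p).1⟩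
    let b : rel σ m → U := fun p => ⟨iter σ j ⟨p.1.2, iterDom_succ_subset σ j (hd p).2⟩,
      iter_mem σ j _ (hd p).2⟩
    have ha : Continuous a := (hc.comp (by fun_prop)).subtype_mk _
    have hb : Continuous b := (hc.comp (by fun_prop)).subtype_mk _
    have hj' : ∀ p : rel σ m, p.1 ∈ rel σ j ↔ a p = b p := fun p =>
      ⟨fun hp => Subtype.ext hp.snd.snd, fun hp => ⟨_, _, congrArg Subtype.val hp⟩⟩
    have hσab : ∀ p : rel σ m, p.1 ∈ rel σ (j + 1) → σ (a p) = σ (b p) :=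
      fun p hp => (iter_succ_eq σ j _ (hd p).1).symm.trans
        (hp.snd.snd.trans (iter_succ_eq σ j _ (hd p).2))
    refine isOpen_iff_mem_nhds.2 fun p hp => ?_
    obtain ⟨e, he, hee⟩ := hσ (a p)
    have hab : a p = b p := (hj' p).1 hp
    have hp1 : p.1 ∈ rel σ (j + 1) := mem_rel_of_le j.le_succ hp (hd p).1 (hd p).2
    filter_upwards [ih.mem_nhds hp1, (e.open_source.preimage ha).mem_nhds he,
      (e.open_source.preimage hb).mem_nhds (show b p ∈ e.source from hab ▸ he)] with q hq hqa hqb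
    refine (hj' q).2 (e.injOn hqa hqb ?_)
    rw [← hee]
    exact hσab q hq

theorem isOpen_setOf_mem_rel (hσ : IsLocalHomeomorph σ) (n : ℕ) :
    IsOpen {γ : GapGroupoid σ | γ.1 ∈ rel σ n} := by
  refine (GapGroupoid.isOpen_iff σ _).2 fun m => ?_
  rcases le_total n m with hnm | hmn
  · exact isOpen_rel_in_rel_of_le hσ hnm
  · have hU := isOpen_iterDom hσ.continuous n
    have : GapGroupoid.incl σ m ⁻¹' {γ : GapGroupoid σ | γ.1 ∈ rel σ n}
        = {p | p.1.1 ∈ iterDom σ n} ∩ {p | p.1.2 ∈ iterDom σ n} := by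
      ext p
      exact ⟨fun hp => ⟨hp.fst, hp.snd.fst⟩, fun hp => mem_rel_of_le hmn p.2 hp.1 hp.2⟩
    rw [this]
    exact (hU.preimage (by fun_prop)).inter (hU.preimage (by fun_prop))

/-- Near a point of `R_n` a pair `(x, y)` lies in `R_n`, and there `x` determines `y` as the solution
of `σ^n y = σ^n x` on a set where `σ^n` is injective. -/
theorem exists_isOpen_injOn_range (hσ : IsLocalHomeomorph σ) (γ : GapGroupoid σ) :
    ∃ O : Set (GapGroupoid σ), IsOpen O ∧ γ ∈ O ∧ Set.InjOn GapGroupoid.range O := by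
  obtain ⟨n, hn⟩ := γ.2
  obtain ⟨e, he, hee⟩ := isLocalHomeomorph_iter hσ n ⟨γ.1.2, hn.snd.fst⟩
  refine ⟨{γ | γ.1 ∈ rel σ n} ∩ GapGroupoid.source ⁻¹' (Subtype.val '' e.source),
    (isOpen_setOf_mem_rel hσ n).inter (((isOpen_iterDom hσ.continuous n).isOpenMap_subtype_val _
      e.open_source).preimage (continuous_source σ)), ⟨hn, _, he, rfl⟩, ?_⟩
  rintro ⟨⟨x, _⟩, h1⟩ ⟨hr1, y1, hy1, rfl⟩ ⟨⟨x', _⟩, h2⟩ ⟨hr2, y2, hy2, rfl⟩ hxx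
  obtain rfl : x = x' := hxx
  have hy : y1 = y2 := by
    refine e.injOn hy1 hy2 ?_
    rw [← hee]
    exact hr1.snd.snd.symm.trans hr2.snd.snd
  subst hy
  rfl

theorem tsum_indicator_const_le_of_injOn {G X : Type*} {r : G → X} {O : Set G}
    (hO : Set.InjOn r O) (M : ℝ≥0∞) (x : X) :
    ∑' γ : r ⁻¹' {x}, O.indicator (fun _ => M) (γ : G) ≤ M := by
  by_cases hx : ∃ γ : r ⁻¹' {x}, (γ : G) ∈ O
  · obtain ⟨γ, hγ⟩ := hx
    rw [tsum_eq_single γ, Set.indicator_of_mem hγ]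
    intro γ' hne
    refine Set.indicator_of_notMem (fun hγ' => hne (Subtype.ext (hO hγ' hγ ?_))) _
    exact γ'.2.trans γ.2.symm
  · push Not at hx
    rw [ENNReal.tsum_eq_zero.2 fun γ => Set.indicator_of_notMem (hx γ) _]
    exact zero_le

/-- The support of `f` is covered by finitely many open sets on which the range map is injective,
so the number of nonzero terms on a fibre is bounded. -/
theorem exists_tsum_enorm_range_le (hσ : IsLocalHomeomorph σ)
    (f : CompactlySupportedContinuousMap (GapGroupoid σ) ℂ) :
    ∃ C : ℝ≥0∞, C ≠ ⊤ ∧ ∀ x, ∑' γ : GapGroupoid.range (σ := σ) ⁻¹' {x}, ‖f γ‖ₑ ≤ C := by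
  choose O hO hmem hinj using exists_isOpen_injOn_range hσ
  obtain ⟨T, -, hT⟩ := f.hasCompactSupport.isCompact.elim_nhds_subcover O
    fun γ _ => (hO γ).mem_nhds (hmem γ)
  obtain ⟨M, hM⟩ := f.hasCompactSupport.exists_bound_of_continuous f.continuous
  have hle : ∀ γ, ‖f γ‖ₑ ≤ ∑ i ∈ T, (O i).indicator (fun _ => ENNReal.ofReal M) γ := by
    intro γ
    by_cases hγ : f γ = 0
    · simp [hγ]
    · obtain ⟨i, hi, hiγ⟩ := Set.mem_iUnion₂.1 (hT (subset_tsupport f hγ))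
      refine le_trans ?_ (Finset.single_le_sum
        (f := fun i => (O i).indicator (fun _ => ENNReal.ofReal M) γ) (fun _ _ => zero_le) hi)
      rw [Set.indicator_of_mem hiγ, ← ofReal_norm]
      exact ENNReal.ofReal_le_ofReal (hM γ)
  refine ⟨∑ i ∈ T, ENNReal.ofReal M, by simp [ENNReal.mul_eq_top], fun x => ?_⟩
  calc ∑' γ : GapGroupoid.range (σ := σ) ⁻¹' {x}, ‖f γ‖ₑ
      ≤ ∑' γ : GapGroupoid.range (σ := σ) ⁻¹' {x}, ∑ i ∈ T,
          (O i).indicator (fun _ => ENNReal.ofReal M) (γ : GapGroupoid σ) :=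
        ENNReal.tsum_le_tsum fun γ => hle γ
    _ = ∑ i ∈ T, ∑' γ : GapGroupoid.range (σ := σ) ⁻¹' {x},
          (O i).indicator (fun _ => ENNReal.ofReal M) (γ : GapGroupoid σ) :=
        Summable.tsum_finsetSum fun _ _ => ENNReal.summable
    _ ≤ _ := Finset.sum_le_sum fun i _ => tsum_indicator_const_le_of_injOn (hinj i) _ x

/-! ### From nonnegative to complex functions -/

/-- `v` is summable over almost every fibre of `r`, and its fibre sums are integrable with
integral `I`. Almost everywhere summability makes the junk values of `∑'` irrelevant. -/
def HasFiberIntegral {G X : Type*} [MeasurableSpace X] (r : G → X) (μ : Measure X) (v : G → ℂ)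
    (I : ℂ) : Prop :=
  (∀ᵐ x ∂μ, Summable fun γ : r ⁻¹' {x} => v γ) ∧
    Integrable (fun x => ∑' γ : r ⁻¹' {x}, v γ) μ ∧ ∫ x, ∑' γ : r ⁻¹' {x}, v γ ∂μ = I

section

variable {G X : Type*} [MeasurableSpace X] {r : G → X} {μ : Measure X}

theorem HasFiberIntegral.add {v w : G → ℂ} {I J : ℂ} (hv : HasFiberIntegral r μ v I)
    (hw : HasFiberIntegral r μ w J) : HasFiberIntegral r μ (fun γ => v γ + w γ) (I + J) := by
  obtain ⟨hv1, hv2, rfl⟩ := hv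
  obtain ⟨hw1, hw2, rfl⟩ := hw
  have hae : (fun x => ∑' γ : r ⁻¹' {x}, v γ + ∑' γ : r ⁻¹' {x}, w γ)
      =ᵐ[μ] fun x => ∑' γ : r ⁻¹' {x}, (v γ + w γ) := by
    filter_upwards [hv1, hw1] with x h1 h2 using (h1.tsum_add h2).symm
  refine ⟨?_, (hv2.add hw2).congr hae, ?_⟩
  · filter_upwards [hv1, hw1] with x h1 h2 using h1.add h2
  · rw [← integral_congr_ae hae, integral_add hv2 hw2]

theorem HasFiberIntegral.const_mul {v : G → ℂ} {I : ℂ} (hv : HasFiberIntegral r μ v I) (z : ℂ) :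
    HasFiberIntegral r μ (fun γ => z * v γ) (z * I) := by
  obtain ⟨hv1, hv2, rfl⟩ := hv
  simp only [HasFiberIntegral, tsum_mul_left]
  refine ⟨?_, hv2.const_mul z, integral_const_mul z _⟩
  filter_upwards [hv1] with x h1 using h1.mul_left z

theorem hasFiberIntegral_of_nonneg {v : G → ℝ} (hv : ∀ γ, 0 ≤ v γ)
    (hm : Measurable fun x => ∑' γ : r ⁻¹' {x}, ENNReal.ofReal (v γ))
    (hfin : ∫⁻ x, ∑' γ : r ⁻¹' {x}, ENNReal.ofReal (v γ) ∂μ ≠ ⊤) :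
    HasFiberIntegral r μ (fun γ => (v γ : ℂ))
      ((∫⁻ x, ∑' γ : r ⁻¹' {x}, ENNReal.ofReal (v γ) ∂μ).toReal : ℂ) := by
  have hae := ae_lt_top hm hfin
  have hv' : ∀ γ, (ENNReal.ofReal (v γ)).toReal = v γ := fun γ => ENNReal.toReal_ofReal (hv γ)
  have h1 : ∀ x, ∑' γ : r ⁻¹' {x}, (v γ : ℂ)
      = ((∑' γ : r ⁻¹' {x}, ENNReal.ofReal (v γ)).toReal : ℂ) := by
    intro x
    rw [ENNReal.tsum_toReal_eq fun _ => ENNReal.ofReal_ne_top, Complex.ofReal_tsum]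
    simp only [hv']
  simp only [HasFiberIntegral, h1]
  refine ⟨?_, (integrable_toReal_of_lintegral_ne_top hm.aemeasurable hfin).ofReal, ?_⟩
  · filter_upwards [hae] with x hx
    have h2 := ENNReal.summable_toReal hx.ne
    simp only [hv'] at h2
    exact Complex.hasSum_ofReal.2 h2.hasSum |>.summable
  · rw [← integral_toReal hm.aemeasurable hae]
    exact integral_ofReal

end

variable [SecondCountableTopology X] [T2Space X] [MeasurableSpace X] [BorelSpace X]

/-- Quasi-invariance for nonnegative continuous functions with integrable fibre sums. Integrability
over the source fibres follows from the equality of the two integrals in `[0, ∞]`. -/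
theorem exists_hasFiberIntegral_of_nonneg (hσ : IsLocalHomeomorph σ) {h : U → ℝ}
    (hh : Continuous h) {μ : Measure X} {b : ℝ≥0∞} (hb0 : b ≠ 0) (hbt : b ≠ ⊤)
    (hμ : ∀ f : U → ℝ≥0∞, Measurable f →
      ∫⁻ x, ruelle σ h f x ∂μ = b * ∫⁻ u, f u ∂(μ.comap (Subtype.val : U → X)))
    {v : GapGroupoid σ → ℝ} (hv : ∀ γ, 0 ≤ v γ) (hvc : Continuous v)
    (hfin : ∫⁻ x, ∑' γ : GapGroupoid.range (σ := σ) ⁻¹' {x}, ENNReal.ofReal (v γ) ∂μ ≠ ⊤) :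
    ∃ I : ℂ, HasFiberIntegral GapGroupoid.range μ (fun γ => (v γ : ℂ)) I ∧
      HasFiberIntegral GapGroupoid.source μ
        (fun γ => (v γ : ℂ) * (Real.exp (cocycle σ h γ) : ℂ)) I := by
  have hwm : ∀ n, Measurable ((fun γ => ENNReal.ofReal (v γ)) ∘ GapGroupoid.incl σ n) :=
    fun n => ENNReal.measurable_ofReal.comp (hvc.comp (continuous_incl σ n)).measurable
  have hwD : ∀ γ, ENNReal.ofReal (v γ) * expCocycle σ h γ
      = ENNReal.ofReal (v γ * Real.exp (cocycle σ h γ)) :=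
    fun γ => (ENNReal.ofReal_mul (hv γ)).symm
  have hms := measurable_tsum_source hσ
    (w := fun γ => ENNReal.ofReal (v γ) * expCocycle σ h γ)
    fun n => (hwm n).mul (measurable_expCocycle_incl hσ hh n)
  have heq := lintegral_tsum_range_eq hσ hh hb0 hbt hμ hwm
  simp only [hwD] at hms
  simp only [hwD] at heq
  refine ⟨_, hasFiberIntegral_of_nonneg hv (measurable_tsum_range hσ hwm) hfin, ?_⟩
  rw [heq] at hfin ⊢
  simpa only [Complex.ofReal_mul] using hasFiberIntegral_of_nonneg
    (v := fun γ => v γ * Real.exp (cocycle σ h γ))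
    (fun γ => mul_nonneg (hv γ) (Real.exp_nonneg _)) hms hfin

theorem complex_eq_parts (z : ℂ) :
    z = ((max z.re 0 : ℝ) : ℂ) + -1 * ((max (-z.re) 0 : ℝ) : ℂ)
      + Complex.I * (((max z.im 0 : ℝ) : ℂ) + -1 * ((max (-z.im) 0 : ℝ) : ℂ)) := by
  have h1 : ∀ t : ℝ, ((max t 0 : ℝ) : ℂ) + -1 * ((max (-t) 0 : ℝ) : ℂ) = (t : ℂ) := by
    intro t
    rw [neg_one_mul, ← sub_eq_add_neg, ← Complex.ofReal_sub, max_zero_sub_max_neg_zero_eq_self]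
  rw [h1, h1, mul_comm, Complex.re_add_im]

/-- A finite eigenmeasure is quasi-invariant: a function in `C_c(R)` is split into four nonnegative
functions, whose fibre sums are bounded and hence integrable. -/
theorem IsRuelleEigenmeasure.isDLR (hσ : IsLocalHomeomorph σ) {h : U → ℝ} (hh : Continuous h)
    {μ : Measure X} [IsFiniteMeasure μ] {a : ℝ} (ha : a ≠ 0)
    (hμ : IsRuelleEigenmeasure σ h μ a) : IsDLR σ h μ := by
  obtain ⟨b, hb0, hbt, hb⟩ := hμ.exists_scalar ha
  intro f
  obtain ⟨C, hC, hfC⟩ := exists_tsum_enorm_range_le hσ f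
  have key : ∀ v : GapGroupoid σ → ℝ, (∀ γ, 0 ≤ v γ) → Continuous v → (∀ γ, v γ ≤ ‖f γ‖) →
      ∃ I : ℂ, HasFiberIntegral GapGroupoid.range μ (fun γ => (v γ : ℂ)) I ∧
        HasFiberIntegral GapGroupoid.source μ
          (fun γ => (v γ : ℂ) * (Real.exp (cocycle σ h γ) : ℂ)) I := by
    intro v hv hvc hvf
    refine exists_hasFiberIntegral_of_nonneg hσ hh hb0 hbt hb hv hvc (ne_top_of_le_ne_top
      (ENNReal.mul_ne_top hC (measure_ne_top μ Set.univ)) ?_)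
    rw [← lintegral_const]
    refine lintegral_mono fun x => (ENNReal.tsum_le_tsum fun γ => ?_).trans (hfC x)
    rw [← ofReal_norm]
    exact ENNReal.ofReal_le_ofReal (hvf γ)
  have hf := f.continuous
  obtain ⟨I₁, hr₁, hs₁⟩ := key (fun γ => max (f γ).re 0) (fun γ => le_max_right _ _)
    (by fun_prop) fun γ => max_le ((le_abs_self _).trans (Complex.abs_re_le_norm _)) (norm_nonneg _)
  obtain ⟨I₂, hr₂, hs₂⟩ := key (fun γ => max (-(f γ).re) 0) (fun γ => le_max_right _ _)
    (by fun_prop) fun γ => max_le ((neg_le_abs _).trans (Complex.abs_re_le_norm _)) (norm_nonneg _)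
  obtain ⟨I₃, hr₃, hs₃⟩ := key (fun γ => max (f γ).im 0) (fun γ => le_max_right _ _)
    (by fun_prop) fun γ => max_le ((le_abs_self _).trans (Complex.abs_im_le_norm _)) (norm_nonneg _)
  obtain ⟨I₄, hr₄, hs₄⟩ := key (fun γ => max (-(f γ).im) 0) (fun γ => le_max_right _ _)
    (by fun_prop) fun γ => max_le ((neg_le_abs _).trans (Complex.abs_im_le_norm _)) (norm_nonneg _)
  have hr := (hr₁.add (hr₂.const_mul (-1))).add
    ((hr₃.add (hr₄.const_mul (-1))).const_mul Complex.I)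
  have hs := (hs₁.add (hs₂.const_mul (-1))).add
    ((hs₃.add (hs₄.const_mul (-1))).const_mul Complex.I)
  have hr' : HasFiberIntegral GapGroupoid.range μ (fun γ => f γ)
      (I₁ + -1 * I₂ + Complex.I * (I₃ + -1 * I₄)) := by
    convert hr using 2 with γ
    exact complex_eq_parts (f γ)
  have hs' : HasFiberIntegral GapGroupoid.source μ
      (fun γ => f γ * (Real.exp (cocycle σ h γ) : ℂ))
      (I₁ + -1 * I₂ + Complex.I * (I₃ + -1 * I₄)) := by
    convert hs using 2 with γ
    conv_lhs => rw [complex_eq_parts (f γ)]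
    ring
  exact hr'.2.2.trans hs'.2.2.symm

end EigenDLR

theorem theorem9p7 {X : Type*} [TopologicalSpace X] [LocallyCompactSpace X]
    [SecondCountableTopology X] [MetrizableSpace X] [MeasurableSpace X] [BorelSpace X]
    (U : Opens X) (σ : U → X) (hσ : IsLocalHomeomorph σ) (h : U → ℝ) (hh : Continuous h)
    (μ : Measure X) [IsFiniteMeasure μ] (a : ℝ) (ha : a ≠ 0)
    (hμ : EigenDLR.IsRuelleEigenmeasure σ h μ a) :
    EigenDLR.IsDLR σ h μ :=
  hμ.isDLR hσ hh ha
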